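/- Let $\mathbb{F}_q$ be a finite field with $q$ elements ($q$ an arbitrary prime power), let $A=\mathbb{F}_q[t]$, let $A_+$ be the set of monic polynomials in $A$, and let $K_\infty=\mathbb{F}_q((1/t))$ be the completion of $\mathbb{F}_q(t)$ at the place at infinity. For positive integers $s_1,\dots,s_r$ let $$\zeta(s_1,\dots,s_r)=\sum \frac{1}{a_1^{s_1}\cdots a_r^{s_r}}\in K_\infty,$$ where the sum is over all $a_1,\dots,a_r\in A_+$ with $\deg a_1>\cdots>\deg a_r\ge 0$ (for $r=1$ this is the Carlitz zeta value $\zeta(s)=\sum_{a\in A_+}a^{-s}$; in general it is Thakur's multizeta value). Then for every integer $n\ge 1$, $$\zeta(q^n)\,\zeta(q^n-1)=\zeta(2q^n-1)+\zeta(q^n-1,q^n).$$ -/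

import Mathlib

open scoped Polynomial

noncomputable section

namespace CarlitzThakur

open scoped WithZero

section Field

variable (F : Type*) [Field F]

/-- The field `K_∞ = F((1/t))`: the completion of `F(t)` at the place at infinity, that is, for the
valuation `|f / g| = exp (deg f - deg g)`. -/
def KInfty : Type _ :=
  letI : DecidableEq (RatFunc F) := Classical.decEq _
  RatFunc.CompletionAtInfty F

instance : Field (KInfty F) :=
  @RatFunc.CompletionAtInfty.instField F _ (Classical.decEq _)

instance : Algebra (RatFunc F) (KInfty F) :=
  @RatFunc.CompletionAtInfty.instAlgebra F _ (Classical.decEq _)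

/-- The valuation, and with it the topology, of `K_∞`. -/
instance : Valued (KInfty F) ℤᵐ⁰ :=
  @RatFunc.CompletionAtInfty.instValuedWithZeroMultiplicativeInt F _ (Classical.decEq _)

instance : CompleteSpace (KInfty F) :=
  let : DecidableEq (RatFunc F) := Classical.decEq _
  let : UniformSpace (RatFunc F) := (RatFunc.inftyValued F).toUniformSpace
  UniformSpace.Completion.completeSpace (RatFunc F)

/-- The inclusion `A = F[t] ⊆ F(t) ⊆ K_∞`. -/
def toKInfty : F[X] →+* KInfty F :=
  (algebraMap (RatFunc F) (KInfty F)).comp (algebraMap F[X] (RatFunc F))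

/-- The tuples `(a₁, …, a_r)` of monic polynomials with `deg a₁ > ⋯ > deg a_r`. -/
abbrev MonicTuple (r : ℕ) : Type _ :=
  {a : Fin r → F[X] // (∀ i, (a i).Monic) ∧ StrictAnti fun i => (a i).natDegree}

variable {F}

/-- The term `1 / (a₁ ^ s₁ ⋯ a_r ^ s_r)` of the multizeta series. -/
def multizetaTerm {r : ℕ} (s : Fin r → ℕ) (a : MonicTuple F r) : KInfty F :=
  ∏ i, (toKInfty F (a.1 i) ^ s i)⁻¹

variable (F) in
/-- Thakur's multizeta value `ζ(s₁, …, s_r) ∈ K_∞`: the sum of `1 / (a₁ ^ s₁ ⋯ a_r ^ s_r)` over all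
monic `a₁, …, a_r` with `deg a₁ > ⋯ > deg a_r ≥ 0`. For `r = 1` this is the Carlitz zeta value, the
sum of `1 / a ^ s` over all monic `a`. The series converges (unconditionally) if `F` is finite and
all `sᵢ` are positive, see `summable_multizetaTerm`. -/
def multizeta {r : ℕ} (s : Fin r → ℕ) : KInfty F :=
  ∑' a : MonicTuple F r, multizetaTerm s a

lemma valued_toKInfty {p : F[X]} (hp : p ≠ 0) :
    Valued.v (toKInfty F p) = WithZero.exp (p.natDegree : ℤ) := by
  let : DecidableEq (RatFunc F) := Classical.decEq _
  let := RatFunc.inftyValued F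
  exact (Valued.valuedCompletion_apply (algebraMap F[X] (RatFunc F) p)).trans
    (RatFunc.inftyValuation.polynomial F hp)

lemma valued_multizetaTerm {r : ℕ} (s : Fin r → ℕ) (a : MonicTuple F r) :
    Valued.v (multizetaTerm s a) = WithZero.exp (-∑ i, (s i * (a.1 i).natDegree : ℤ)) := by
  rw [multizetaTerm, map_prod]
  have h : ∀ i, Valued.v (toKInfty F (a.1 i) ^ s i)⁻¹ =
      WithZero.exp (-(s i * (a.1 i).natDegree : ℤ)) := fun i => by
    rw [map_inv₀, map_pow, valued_toKInfty (a.2.1 i).ne_zero, ← WithZero.exp_nsmul,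
      ← WithZero.exp_neg, nsmul_eq_mul]
  simp_rw [h]
  rw [← Finset.sum_neg_distrib]
  induction (Finset.univ : Finset (Fin r)) using Finset.cons_induction with
  | empty => simp
  | cons i t hi ih => rw [Finset.prod_cons, Finset.sum_cons, ih, WithZero.exp_add]

end Field

/-- There are finitely many polynomials of bounded degree over a finite field. -/
lemma finite_natDegree_le (F : Type*) [Field F] [Finite F] (N : ℕ) :
    {p : F[X] | p.natDegree ≤ N}.Finite := by
  refine Set.Finite.of_injOn (f := fun p : F[X] => fun i : Fin (N + 1) => p.coeff i)
    (t := Set.univ) (fun _ _ => Set.mem_univ _) ?_ Set.finite_univ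
  intro p hp p' hp' h
  ext k
  by_cases hk : k < N + 1
  · exact congrFun h ⟨k, hk⟩
  · rw [Polynomial.coeff_eq_zero_of_natDegree_lt (lt_of_le_of_lt hp (by omega)),
      Polynomial.coeff_eq_zero_of_natDegree_lt (lt_of_le_of_lt hp' (by omega))]

/-- The multizeta series converge. -/
theorem summable_multizetaTerm {F : Type*} [Field F] [Finite F] {r : ℕ} (s : Fin r → ℕ)
    (hs : ∀ i, 0 < s i) : Summable (multizetaTerm (F := F) s) := by
  have : NonarchimedeanRing (KInfty F) := by
    have h := (Valued.v : Valuation (KInfty F) ℤᵐ⁰).subgroups_basis.nonarchimedean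
    have e : (inferInstance : TopologicalSpace (KInfty F)) =
        (Valued.v : Valuation (KInfty F) ℤᵐ⁰).subgroups_basis.topology :=
      congrArg (fun u => u.toTopologicalSpace) (Valued.toUniformSpace_eq (KInfty F) ℤᵐ⁰)
    rw [← e] at h
    exact h
  apply NonarchimedeanAddGroup.summable_of_tendsto_cofinite_zero
  rw [(Valued.hasBasis_nhds_zero (KInfty F) ℤᵐ⁰).tendsto_right_iff]
  intro γ _
  simp only [Set.mem_ofPred_eq, Valuation.restrict_lt_iff_lt_embedding]
  generalize hδ : MonoidWithZeroHom.ValueGroup₀.embedding (γ : MonoidWithZeroHom.ValueGroup₀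
    (.ofClass (Valued.v : Valuation (KInfty F) ℤᵐ⁰))) = δ
  have hδ0 : δ ≠ 0 := by
    rw [← hδ]; simp
  rw [Filter.eventually_cofinite]
  have hf : {a : MonicTuple F r | ∀ i, ((a.1 i).natDegree : ℤ) ≤ -WithZero.log δ}.Finite := by
    refine Set.Finite.of_finite_image (f := Subtype.val) ?_ Subtype.val_injective.injOn
    refine (Set.Finite.pi' (t := fun _ : Fin r => {p : F[X] | p.natDegree ≤
      (-WithZero.log δ).toNat}) fun _ => finite_natDegree_le F _).subset ?_
    rintro _ ⟨a, ha, rfl⟩ i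
    have := ha i
    simp only [Set.mem_ofPred_eq]
    omega
  refine hf.subset fun a ha i => ?_
  simp only [Set.mem_ofPred_eq, not_lt, valued_multizetaTerm] at ha
  rw [← WithZero.log_le_iff_le_exp hδ0] at ha
  have h1 : (s i * (a.1 i).natDegree : ℤ) ≤ ∑ i, (s i * (a.1 i).natDegree : ℤ) :=
    Finset.single_le_sum (f := fun i => (s i * (a.1 i).natDegree : ℤ))
      (fun _ _ => by positivity) (Finset.mem_univ i)
  have h2 : ((a.1 i).natDegree : ℤ) ≤ s i * (a.1 i).natDegree :=
    le_mul_of_one_le_left (by positivity) (by exact_mod_cast hs i)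
  linarith

end CarlitzThakur

end

open scoped Polynomial

noncomputable section

namespace CarlitzThakur

variable (F : Type*) [Field F]

/-! Put Q = q^n, and let S_d(k), S_{<d}(k) be the sums of a^(-k) over monic a of degree d, resp.
less than d. The heart is the finite identity S_d(Q) S_{<d+1}(Q-1) = S_d(2Q-1)
(`sum_monicEq_mul_sum_monicLT_succ`). In S_d(Q) S_d(Q-1) the diagonal gives S_d(2Q-1). Off it, b = a
+ c with c ≠ 0 of degree below d, and a partial fraction coming from additivity of x ↦ x^Q, summed
over a, leaves S_d(Q) ∑ c^(-(Q-1)). Since q - 1 divides Q - 1, this is -S_d(Q) S_{<d}(Q-1),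
cancelling the lower-degree terms. Summing over d, the pairs with deg a ≤ deg b or the reverse sort
themselves into the two zeta values; truncating by degree and passing to the limit finishes. -/

lemma toKInfty_injective : Function.Injective (toKInfty F) :=
  (injective_iff_map_eq_zero _).2 fun p hp => by
    by_contra h
    have := valued_toKInfty h
    rw [hp, map_zero] at this
    exact WithZero.exp_ne_zero this.symm

variable [Finite F]

/-- The monic polynomials of degree less than `N`. -/
def monicLT (N : ℕ) : Finset F[X] :=
  (Set.Finite.subset (s := {p : F[X] | p.natDegree ≤ N}) (finite_natDegree_le F N)
    (t := {p : F[X] | p.Monic ∧ p.natDegree < N}) fun _ h => h.2.le).toFinset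

/-- The monic polynomials of degree `d`. -/
def monicEq (d : ℕ) : Finset F[X] :=
  (Set.Finite.subset (s := {p : F[X] | p.natDegree ≤ d}) (finite_natDegree_le F d)
    (t := {p : F[X] | p.Monic ∧ p.natDegree = d}) fun _ h => h.2.le).toFinset

/-- The nonzero polynomials of degree less than `d`. -/
def nonzeroLT (d : ℕ) : Finset F[X] :=
  (Set.Finite.subset (s := {p : F[X] | p.natDegree ≤ d}) (finite_natDegree_le F d)
    (t := {p : F[X] | p ≠ 0 ∧ p.natDegree < d}) fun _ h => h.2.le).toFinset

variable {F}

@[simp] lemma mem_monicLT {N : ℕ} {p : F[X]} : p ∈ monicLT F N ↔ p.Monic ∧ p.natDegree < N := by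
  simp [monicLT]

@[simp] lemma mem_monicEq {d : ℕ} {p : F[X]} : p ∈ monicEq F d ↔ p.Monic ∧ p.natDegree = d := by
  simp [monicEq]

@[simp] lemma mem_nonzeroLT {d : ℕ} {p : F[X]} :
    p ∈ nonzeroLT F d ↔ p ≠ 0 ∧ p.natDegree < d := by
  simp [nonzeroLT]

lemma sum_monicLT_succ {M : Type*} [AddCommMonoid M] (N : ℕ) (f : F[X] → M) :
    ∑ a ∈ monicLT F (N + 1), f a = ∑ a ∈ monicLT F N, f a + ∑ a ∈ monicEq F N, f a := by
  classical
  rw [← Finset.sum_union]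
  · refine Finset.sum_congr ?_ fun _ _ => rfl
    ext p
    simp only [mem_monicLT, mem_monicEq, Finset.mem_union]
    rw [Nat.lt_succ_iff_lt_or_eq]
    tauto
  · rw [Finset.disjoint_left]
    intro p h h'
    simp only [mem_monicLT, mem_monicEq] at h h'
    omega

lemma add_mem_monicEq {d : ℕ} {a c : F[X]} (ha : a ∈ monicEq F d) (hc : c ∈ nonzeroLT F d) :
    a + c ∈ monicEq F d := by
  rw [mem_monicEq] at ha ⊢
  rw [mem_nonzeroLT] at hc
  have h : c.natDegree < a.natDegree := hc.2.trans_eq ha.2.symm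
  exact ⟨ha.1.add_of_left (Polynomial.degree_lt_degree h),
    (Polynomial.natDegree_add_eq_left_of_natDegree_lt h).trans ha.2⟩

lemma neg_mem_nonzeroLT {d : ℕ} {c : F[X]} (hc : c ∈ nonzeroLT F d) : -c ∈ nonzeroLT F d := by
  simpa using hc

lemma sub_mem_nonzeroLT {d : ℕ} {a b : F[X]} (ha : a ∈ monicEq F d) (hb : b ∈ monicEq F d)
    (h : b ≠ a) : b - a ∈ nonzeroLT F d := by
  rw [mem_monicEq] at ha hb
  rw [mem_nonzeroLT]
  have h0 : b - a ≠ 0 := sub_ne_zero.2 h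
  refine ⟨h0, ?_⟩
  have h1 : (b - a).degree < b.degree := Polynomial.degree_sub_lt_left
    (by rw [Polynomial.degree_eq_natDegree hb.1.ne_zero,
      Polynomial.degree_eq_natDegree ha.1.ne_zero, ha.2, hb.2])
    hb.1.ne_zero (by rw [hb.1.leadingCoeff, ha.1.leadingCoeff])
  have := Polynomial.natDegree_lt_natDegree h0 h1
  omega

lemma sum_monicEq_add {M : Type*} [AddCommMonoid M] {d : ℕ} {c : F[X]} (hc : c ∈ nonzeroLT F d)
    (f : F[X] → M) : ∑ a ∈ monicEq F d, f (a + c) = ∑ a ∈ monicEq F d, f a :=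
  Finset.sum_bij' (fun a _ => a + c) (fun a _ => a + -c)
    (fun _ ha => add_mem_monicEq ha hc) (fun _ ha => add_mem_monicEq ha (neg_mem_nonzeroLT hc))
    (by simp) (by simp) (by simp)

lemma sum_monicEq_eq_add_sum_nonzeroLT {M : Type*} [AddCommMonoid M] {d : ℕ} {a : F[X]}
    (ha : a ∈ monicEq F d) (f : F[X] → M) :
    ∑ b ∈ monicEq F d, f b = f a + ∑ c ∈ nonzeroLT F d, f (a + c) := by
  classical
  rw [← Finset.add_sum_erase _ _ ha]
  congr 1
  refine Finset.sum_bij' (fun b _ => b - a) (fun c _ => a + c) ?_ ?_ ?_ ?_ ?_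
  · intro b hb
    exact sub_mem_nonzeroLT ha (Finset.mem_of_mem_erase hb) (Finset.ne_of_mem_erase hb)
  · intro c hc
    exact Finset.mem_erase.2 ⟨by simpa using (mem_nonzeroLT.1 hc).1, add_mem_monicEq ha hc⟩
  all_goals simp

/-- Every nonzero polynomial is uniquely a unit times a monic polynomial. -/
lemma sum_nonzeroLT_eq_neg {K : Type*} [Field K] (φ : F[X] →+* K) (d k : ℕ)
    (hk : Nat.card F - 1 ∣ k) :
    ∑ c ∈ nonzeroLT F d, (φ c ^ k)⁻¹ = -∑ b ∈ monicLT F d, (φ b ^ k)⁻¹ := by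
  classical
  have := Fintype.ofFinite F
  -- The q - 1 units contribute equally, and q = 0 in K, so they count as -1.
  have hcard : ((Fintype.card Fˣ : ℕ) : K) = -1 := by
    rw [Fintype.card_units, Nat.cast_sub Fintype.card_pos]
    have h : ((Fintype.card F : ℕ) : F) = 0 := Nat.cast_card_eq_zero F
    have h' := congrArg (φ.comp Polynomial.C) h
    rw [map_natCast, map_zero] at h'
    rw [h']
    simp
  have key : ∑ c ∈ nonzeroLT F d, (φ c ^ k)⁻¹ =
      ∑ x ∈ (Finset.univ : Finset Fˣ) ×ˢ monicLT F d, (φ x.2 ^ k)⁻¹ := by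
    symm
    refine Finset.sum_bij (fun x _ => Polynomial.C (x.1 : F) * x.2) ?_ ?_ ?_ ?_
    · rintro ⟨u, b⟩ h
      simp only [Finset.mem_product, Finset.mem_univ, true_and, mem_monicLT] at h
      rw [mem_nonzeroLT, Polynomial.natDegree_C_mul u.ne_zero]
      exact ⟨mul_ne_zero (Polynomial.C_ne_zero.2 u.ne_zero) h.1.ne_zero, h.2⟩
    · rintro ⟨u, b⟩ h ⟨u', b'⟩ h' e
      simp only [Finset.mem_product, Finset.mem_univ, true_and, mem_monicLT] at h h' e
      have e' := congrArg Polynomial.leadingCoeff e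
      rw [Polynomial.leadingCoeff_mul, Polynomial.leadingCoeff_mul, h.1.leadingCoeff,
        h'.1.leadingCoeff, Polynomial.leadingCoeff_C, Polynomial.leadingCoeff_C, mul_one,
        mul_one] at e'
      have eu : u = u' := Units.ext e'
      subst eu
      rw [mul_left_cancel₀ (Polynomial.C_ne_zero.2 u.ne_zero) e]
    · intro c hc
      rw [mem_nonzeroLT] at hc
      have hl : c.leadingCoeff ≠ 0 := Polynomial.leadingCoeff_ne_zero.2 hc.1
      refine ⟨(Units.mk0 _ hl, Polynomial.C c.leadingCoeff⁻¹ * c), ?_, ?_⟩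
      · simp only [Finset.mem_product, Finset.mem_univ, true_and, mem_monicLT]
        rw [Polynomial.natDegree_C_mul (inv_ne_zero hl)]
        refine ⟨?_, hc.2⟩
        rw [Polynomial.Monic, Polynomial.leadingCoeff_mul, Polynomial.leadingCoeff_C,
          inv_mul_cancel₀ hl]
      · simp only [Units.val_mk0]
        rw [← mul_assoc, ← Polynomial.C_mul, mul_inv_cancel₀ hl, Polynomial.C_1, one_mul]
    · rintro ⟨u, b⟩ -
      obtain ⟨m, rfl⟩ := hk
      -- Divisibility of the exponent by q - 1 is what makes the k-th power blind to the unit.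
      have hu : (u : F) ^ ((Nat.card F - 1) * m) = 1 := by
        rw [pow_mul, Nat.card_eq_fintype_card, FiniteField.pow_card_sub_one_eq_one _ u.ne_zero,
          one_pow]
      simp only [map_mul, mul_pow]
      rw [← map_pow φ (Polynomial.C _), ← map_pow Polynomial.C, hu, map_one, map_one, one_mul]
  rw [key, Finset.sum_product]
  dsimp only
  rw [Finset.sum_const, Finset.card_univ, nsmul_eq_mul, hcard, neg_one_mul]

/-! ### Identities between finite power sums -/

/-- An iterate of Frobenius; `φ` serves only to give K the characteristic of F. -/
lemma map_add_pow_card_pow {K : Type*} [Field K] (φ : F[X] →+* K) (n : ℕ) (x y : K) :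
    (x + y) ^ Nat.card F ^ n = x ^ Nat.card F ^ n + y ^ Nat.card F ^ n := by
  have := Fintype.ofFinite F
  obtain ⟨p, hp⟩ := CharP.exists F
  obtain ⟨m, hprime, hm⟩ := FiniteField.card F p
  have : Fact p.Prime := ⟨hprime⟩
  have : CharP K p := charP_of_injective_ringHom (φ.comp Polynomial.C).injective p
  rw [Nat.card_eq_fintype_card, hm, ← pow_mul, add_pow_char_pow]

/-- Clearing denominators turns this into `hadd`. The form is chosen so that the last bracket
cancels when summed over a set of x stable under translation by y. -/
lemma inv_pow_mul_inv_pow_partial_fraction {K : Type*} [Field K] {Q : ℕ} (hQ : 1 ≤ Q) {x y : K}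
    (hx : x ≠ 0) (hy : y ≠ 0) (hxy : x + y ≠ 0) (hadd : (x + y) ^ Q = x ^ Q + y ^ Q) :
    (x ^ Q)⁻¹ * ((x + y) ^ (Q - 1))⁻¹ = (x ^ Q)⁻¹ * (y ^ (Q - 1))⁻¹ +
      (y ^ Q)⁻¹ * ((x ^ (Q - 1))⁻¹ - ((x + y) ^ (Q - 1))⁻¹) := by
  obtain ⟨P, rfl⟩ := Nat.exists_eq_add_of_le' hQ
  simp only [Nat.add_sub_cancel]
  have h1 : x ^ P ≠ 0 := pow_ne_zero _ hx
  have h2 : y ^ P ≠ 0 := pow_ne_zero _ hy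
  have h3 : (x + y) ^ P ≠ 0 := pow_ne_zero _ hxy
  rw [pow_succ, pow_succ, pow_succ] at hadd
  rw [pow_succ, pow_succ]
  generalize x ^ P = X at *
  generalize y ^ P = Y at *
  generalize (x + y) ^ P = Z at *
  field_simp
  linear_combination -hadd

lemma sum_monicEq_mul_sum_monicLT_succ {K : Type*} [Field K] (φ : F[X] →+* K)
    (hφ : Function.Injective φ) (n d : ℕ) :
    (∑ a ∈ monicEq F d, (φ a ^ Nat.card F ^ n)⁻¹) *
        ∑ b ∈ monicLT F (d + 1), (φ b ^ (Nat.card F ^ n - 1))⁻¹ =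
      ∑ a ∈ monicEq F d, (φ a ^ (2 * Nat.card F ^ n - 1))⁻¹ := by
  have hφ0 {p : F[X]} (hp : p ≠ 0) : φ p ≠ 0 := (map_ne_zero_iff φ hφ).2 hp
  have hadd := map_add_pow_card_pow φ n
  have hQ : 1 ≤ Nat.card F ^ n := Nat.one_le_pow _ _ Nat.card_pos
  have hneg := sum_nonzeroLT_eq_neg φ d (Nat.card F ^ n - 1)
    (by simpa using Nat.sub_dvd_pow_sub_pow (Nat.card F) 1 n)
  generalize Nat.card F ^ n = Q at *
  have hdiag : (∑ a ∈ monicEq F d, (φ a ^ Q)⁻¹) * ∑ b ∈ monicEq F d, (φ b ^ (Q - 1))⁻¹ =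
      ∑ a ∈ monicEq F d, (φ a ^ (2 * Q - 1))⁻¹ +
        ∑ a ∈ monicEq F d, ∑ c ∈ nonzeroLT F d, (φ a ^ Q)⁻¹ * (φ (a + c) ^ (Q - 1))⁻¹ := by
    rw [Finset.sum_mul, ← Finset.sum_add_distrib]
    refine Finset.sum_congr rfl fun a ha => ?_
    rw [sum_monicEq_eq_add_sum_nonzeroLT ha, mul_add, Finset.mul_sum, ← mul_inv, ← pow_add]
    congr 4
    omega
  have hoff : ∑ a ∈ monicEq F d, ∑ c ∈ nonzeroLT F d, (φ a ^ Q)⁻¹ * (φ (a + c) ^ (Q - 1))⁻¹ =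
      (∑ a ∈ monicEq F d, (φ a ^ Q)⁻¹) * ∑ c ∈ nonzeroLT F d, (φ c ^ (Q - 1))⁻¹ := by
    rw [Finset.sum_comm, Finset.mul_sum]
    refine Finset.sum_congr rfl fun c hc => ?_
    have : ∀ a ∈ monicEq F d, (φ a ^ Q)⁻¹ * (φ (a + c) ^ (Q - 1))⁻¹ =
        (φ a ^ Q)⁻¹ * (φ c ^ (Q - 1))⁻¹ +
          (φ c ^ Q)⁻¹ * ((φ a ^ (Q - 1))⁻¹ - (φ (a + c) ^ (Q - 1))⁻¹) := fun a ha => by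
      have hac := hφ0 (mem_monicEq.1 (add_mem_monicEq ha hc)).1.ne_zero
      rw [map_add] at hac ⊢
      exact inv_pow_mul_inv_pow_partial_fraction hQ (hφ0 (mem_monicEq.1 ha).1.ne_zero)
        (hφ0 (mem_nonzeroLT.1 hc).1) hac (hadd _ _)
    -- Translation by c permutes the monic polynomials of degree d, so the bracket sums to zero.
    rw [Finset.sum_congr rfl this, Finset.sum_add_distrib, ← Finset.sum_mul, ← Finset.mul_sum,
      Finset.sum_sub_distrib, sum_monicEq_add hc fun a => (φ a ^ (Q - 1))⁻¹, sub_self, mul_zero,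
      add_zero]
  rw [sum_monicLT_succ, mul_add, hdiag, hoff, hneg]
  ring

/-- Raising N by one adds the pairs with deg a = N, evaluated by the fixed-degree identity, and
those with deg b = N > deg a, which form the new part of the double sum. -/
lemma sum_monicLT_mul_sum_monicLT {K : Type*} [Field K] (φ : F[X] →+* K)
    (hφ : Function.Injective φ) (n N : ℕ) :
    (∑ a ∈ monicLT F N, (φ a ^ Nat.card F ^ n)⁻¹) *
        ∑ b ∈ monicLT F N, (φ b ^ (Nat.card F ^ n - 1))⁻¹ =
      ∑ a ∈ monicLT F N, (φ a ^ (2 * Nat.card F ^ n - 1))⁻¹ +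
        ∑ a ∈ monicLT F N, ∑ b ∈ monicLT F a.natDegree,
          (φ a ^ (Nat.card F ^ n - 1))⁻¹ * (φ b ^ Nat.card F ^ n)⁻¹ := by
  induction N with
  | zero =>
    have : monicLT F 0 = ∅ := by ext; simp
    simp [this]
  | succ N ih =>
    have key := sum_monicEq_mul_sum_monicLT_succ φ hφ n N
    have h : ∑ a ∈ monicEq F N, ∑ b ∈ monicLT F a.natDegree,
          (φ a ^ (Nat.card F ^ n - 1))⁻¹ * (φ b ^ Nat.card F ^ n)⁻¹ =
        (∑ a ∈ monicEq F N, (φ a ^ (Nat.card F ^ n - 1))⁻¹) *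
          ∑ b ∈ monicLT F N, (φ b ^ Nat.card F ^ n)⁻¹ := by
      rw [Finset.sum_mul]
      refine Finset.sum_congr rfl fun a ha => ?_
      rw [(mem_monicEq.1 ha).2, Finset.mul_sum]
    rw [sum_monicLT_succ] at key
    simp only [sum_monicLT_succ _ _, h]
    linear_combination ih + key

/-! ### Truncation by degree and passage to the limit -/

variable (F) in
/-- The tuples in `MonicTuple F r` all of whose entries have degree less than `N`. -/
def monicTupleLT (r N : ℕ) : Finset (MonicTuple F r) :=
  (Set.Finite.of_finite_image (s := {a : MonicTuple F r | ∀ i, (a.1 i).natDegree < N})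
    (f := Subtype.val)
    ((Set.Finite.pi' (t := fun _ : Fin r => {p : F[X] | p.natDegree ≤ N})
      fun _ => finite_natDegree_le F _).subset
        (by rintro _ ⟨a, ha, rfl⟩ i; exact (ha i).le))
    Subtype.val_injective.injOn).toFinset

@[simp] lemma mem_monicTupleLT {r N : ℕ} {a : MonicTuple F r} :
    a ∈ monicTupleLT F r N ↔ ∀ i, (a.1 i).natDegree < N := by
  simp [monicTupleLT]

lemma tendsto_sum_monicTupleLT {r : ℕ} (s : Fin r → ℕ) (hs : ∀ i, 0 < s i) :
    Filter.Tendsto (fun N => ∑ a ∈ monicTupleLT F r N, multizetaTerm s a) Filter.atTop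
      (nhds (multizeta F s)) := by
  refine (summable_multizetaTerm s hs).hasSum.comp
    (Filter.tendsto_atTop_finset_of_monotone ?_ ?_)
  · intro M N h a ha
    rw [mem_monicTupleLT] at ha ⊢
    exact fun i => (ha i).trans_le h
  · intro a
    -- The sum of the degrees bounds each of them, also when r = 0.
    refine ⟨∑ i, (a.1 i).natDegree + 1, mem_monicTupleLT.2 fun i => Nat.lt_succ_of_le ?_⟩
    exact Finset.single_le_sum (f := fun i => (a.1 i).natDegree) (fun _ _ => Nat.zero_le _)
      (Finset.mem_univ i)

lemma sum_monicTupleLT_one (k N : ℕ) :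
    ∑ a ∈ monicTupleLT F 1 N, multizetaTerm ![k] a =
      ∑ a ∈ monicLT F N, (toKInfty F a ^ k)⁻¹ := by
  refine Finset.sum_bij (fun a _ => a.1 0) ?_ ?_ ?_ ?_
  · intro a ha
    exact mem_monicLT.2 ⟨a.2.1 0, mem_monicTupleLT.1 ha 0⟩
  · intro a _ b _ h
    refine Subtype.ext (funext fun i => ?_)
    rwa [Subsingleton.elim i 0]
  · intro p hp
    rw [mem_monicLT] at hp
    exact ⟨⟨fun _ => p, fun _ => hp.1, Subsingleton.strictAnti _⟩,
      mem_monicTupleLT.2 fun _ => hp.2, rfl⟩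
  · intro a _
    simp [multizetaTerm]

lemma sum_monicTupleLT_two (k l N : ℕ) :
    ∑ a ∈ monicTupleLT F 2 N, multizetaTerm ![k, l] a =
      ∑ a ∈ monicLT F N, ∑ b ∈ monicLT F a.natDegree,
        (toKInfty F a ^ k)⁻¹ * (toKInfty F b ^ l)⁻¹ := by
  rw [Finset.sum_sigma']
  refine Finset.sum_bij (fun a _ => ⟨a.1 0, a.1 1⟩) ?_ ?_ ?_ ?_
  · intro a ha
    rw [mem_monicTupleLT] at ha
    rw [Finset.mem_sigma, mem_monicLT, mem_monicLT]
    exact ⟨⟨a.2.1 0, ha 0⟩, a.2.1 1, a.2.2 (by simp)⟩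
  · intro a _ b _ h
    simp only [Sigma.mk.injEq, heq_eq_eq] at h
    exact Subtype.ext (funext (Fin.forall_fin_two.2 h))
  · rintro ⟨p, p'⟩ hp
    rw [Finset.mem_sigma, mem_monicLT, mem_monicLT] at hp
    obtain ⟨⟨h1, h2⟩, h3, h4⟩ := hp
    refine ⟨⟨![p, p'], Fin.forall_fin_two.2 ⟨h1, h3⟩, ?_⟩, ?_, rfl⟩
    · rw [Fin.strictAnti_iff_succ_lt]
      intro i
      rw [Subsingleton.elim i 0]
      exact h4
    · exact mem_monicTupleLT.2 (Fin.forall_fin_two.2 ⟨h2, h4.trans h2⟩)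
  · intro a _
    simp [multizetaTerm, Fin.prod_univ_two, mul_comm]

end CarlitzThakur

end

open CarlitzThakur in
theorem theorem6p2 (F : Type*) [Field F] [Finite F] (q : ℕ) (hq : Nat.card F = q)
    (n : ℕ) (hn : 1 ≤ n) :
    multizeta F ![q ^ n] * multizeta F ![q ^ n - 1] =
      multizeta F ![2 * q ^ n - 1] + multizeta F ![q ^ n - 1, q ^ n] := by
  subst hq
  -- Here n ≥ 1 enters: it makes the exponent q^n - 1 positive, as convergence requires.
  have hQ : 1 < Nat.card F ^ n := Nat.one_lt_pow (by omega) Finite.one_lt_card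
  have h1 (k : ℕ) (hk : 0 < k) := tendsto_sum_monicTupleLT (F := F) ![k] (by simpa using hk)
  have h2 := tendsto_sum_monicTupleLT (F := F) ![Nat.card F ^ n - 1, Nat.card F ^ n]
    (Fin.forall_fin_two.2 ⟨Nat.sub_pos_of_lt hQ, zero_lt_one.trans hQ⟩)
  refine tendsto_nhds_unique ((h1 _ (by omega)).mul (h1 _ (by omega)))
    (((h1 _ (by omega)).add h2).congr fun N => ?_)
  rw [sum_monicTupleLT_one, sum_monicTupleLT_one, sum_monicTupleLT_one, sum_monicTupleLT_two]
  exact (sum_monicLT_mul_sum_monicLT (toKInfty F) (toKInfty_injective F) n N).symm
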